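/- Let $a,b,d,e,f\in\{0,\tfrac12,1,\tfrac32,\dots\}$ be angular momenta such that $(a,d,e)$, $(b,e,d)$, $(d,e,f)$ and $(e,d,a+b+f)$ are triads, where $(j_1,j_2,j_3)$ is a triad if $j_1+j_2+j_3$ is an integer and $|j_1-j_2|\le j_3\le j_1+j_2$. Put $$\Delta(j_1,j_2,j_3)=\left[\frac{(j_1+j_2-j_3)!\,(j_1-j_2+j_3)!\,(-j_1+j_2+j_3)!}{(j_1+j_2+j_3+1)!}\right]^{1/2},$$ $$P=(-1)^{a+d-e}\,\frac{\Delta(a+b+f,e,d)}{\Delta(a,d,e)\,\Delta(b,e,d)\,\Delta(d,e,f)}\left[\frac{(2a)!\,(2b)!\,(2f)!}{(2a+2b+1)\,(2a+2b+2f+1)!}\right]^{1/2}\frac{a+b+e+d+f+1}{(a+e+d+1)(b+e+d+1)(d+e+f+1)},$$ and let ${}_5F_4[\alpha_1,\dots,\alpha_5;\beta_1,\dots,\beta_4;1]=\sum_{k\ge 0}\frac{(\alpha_1)_k\cdots(\alpha_5)_k}{(\beta_1)_k\cdots(\beta_4)_k\,k!}$ with $(\alpha)_k=\alpha(\alpha+1)\cdots(\alpha+k-1)$.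 Let $n=e+d-a-b-f$, which is a nonnegative integer. If $n\neq 0$, the Wigner $9j$ symbol satisfies $$\begin{Bmatrix} a&b&a+b\\ d&e&f\\ e&d&a+b+f\end{Bmatrix}=P\cdot{}_5F_4\!\left[\begin{matrix}\frac n2+1,\ n,\ -b-f,\ -a-f,\ -a-b\\ \frac n2,\ e+d-a+1,\ e+d-b+1,\ e+d-f+1\end{matrix};1\right].$$ If $n=0$, the same holds with the ${}_5F_4$ understood as its limit at fixed $a,b,f$, that is, $$\begin{Bmatrix} a&b&a+b\\ d&e&f\\ e&d&a+b+f\end{Bmatrix}=\lim_{\nu\to0,\ \nu\ne0}P\cdot{}_5F_4\!\left[\begin{matrix}\frac \nu2+1,\ \nu,\ -b-f,\ -a-f,\ -a-b\\ \frac \nu2,\ b+f+\nu+1,\ a+f+\nu+1,\ a+b+\nu+1\end{matrix};1\right].$$ -/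

import Mathlib

open scoped Topology

noncomputable section

/-- Three angular momenta `a, b, c ∈ {0, 1/2, 1, 3/2, …}` satisfying the triangular conditions:
their sum is an integer and `|a - b| ≤ c ≤ a + b`. -/
structure IsTriad (a b c : ℝ) : Prop where
  half_left : ∃ k : ℕ, a = k / 2
  half_mid : ∃ k : ℕ, b = k / 2
  half_right : ∃ k : ℕ, c = k / 2
  sum_int : ∃ k : ℕ, a + b + c = k
  lower : |a - b| ≤ c
  upper : c ≤ a + b

/-- The factorial `x! = Γ(x + 1)`; below, `x` is always a nonnegative integer. -/
def fac (x : ℝ) : ℝ := Real.Gamma (x + 1)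

/-- The triangle coefficient
`Δ(a,b,c) = [(a+b-c)! (a-b+c)! (-a+b+c)! / (a+b+c+1)!] ^ (1/2)`. -/
def triangleCoeff (a b c : ℝ) : ℝ :=
  Real.sqrt (fac (a + b - c) * fac (a - b + c) * fac (-a + b + c) / fac (a + b + c + 1))

open Classical in
/-- The Wigner `6j` symbol `{a b c; d e f}`, by Racah's formula. It is zero unless
`(a,b,c)`, `(a,e,f)`, `(d,b,f)`, `(d,e,c)` are triads; the sum is over all integers `t`
for which every factorial has a nonnegative argument. -/
def sixJ (a b c d e f : ℝ) : ℝ :=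
  if IsTriad a b c ∧ IsTriad a e f ∧ IsTriad d b f ∧ IsTriad d e c then
    triangleCoeff a b c * triangleCoeff a e f * triangleCoeff d b f * triangleCoeff d e c *
      ∑ t ∈ (Finset.range (⌊a + b + d + e⌋₊ + 1)).filter (fun t : ℕ =>
          a + b + c ≤ t ∧ a + e + f ≤ t ∧ d + b + f ≤ t ∧ d + e + c ≤ t ∧
          (t : ℝ) ≤ a + b + d + e ∧ (t : ℝ) ≤ b + c + e + f ∧ (t : ℝ) ≤ c + a + f + d),
        (-1 : ℝ) ^ t * fac ((t : ℝ) + 1) /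
          (fac (t - (a + b + c)) * fac (t - (a + e + f)) *
            fac (t - (d + b + f)) * fac (t - (d + e + c)) *
            fac (a + b + d + e - t) * fac (b + c + e + f - t) * fac (c + a + f + d - t))
  else 0

/-- The Wigner `9j` symbol with rows `(a,b,c)`, `(d,e,f)`, `(g,h,i)`:
`∑ₓ (-1)^(2x) (2x+1) {a d g; h i x} {b e h; d x f} {c f i; x a b}`,
over all `x = k/2`, `k = 0, 1, 2, …`. The first `6j` symbol vanishes unless `x ≤ a + i`,
so that it is enough to sum over `k ≤ 2(a + i)`. -/
def nineJ (a b c d e f g h i : ℝ) : ℝ :=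
  ∑ k ∈ Finset.range (⌊2 * (a + i)⌋₊ + 1),
    (-1 : ℝ) ^ k * (2 * ((k : ℝ) / 2) + 1) *
      sixJ a d g h i ((k : ℝ) / 2) * sixJ b e h d ((k : ℝ) / 2) f * sixJ c f i ((k : ℝ) / 2) a b

/-- The generalized hypergeometric series
`ₚF_q[as; bs; z] = ∑ₖ (∏ (aᵢ)ₖ / ∏ (bⱼ)ₖ) zᵏ / k!`, with `(a)ₖ = a (a+1) ⋯ (a+k-1)`. -/
def hypergeom (as bs : List ℝ) (z : ℝ) : ℝ :=
  ∑' k : ℕ, (as.map fun a => (ascPochhammer ℝ k).eval a).prod /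
    (bs.map fun b => (ascPochhammer ℝ k).eval b).prod * z ^ k / (k.factorial : ℝ)

/-- The factor in front of the hypergeometric series; `a + d - e` is an integer for triads
`(a,d,e)`, and the real power `(-1) ^ (a + d - e)` is then the usual sign. -/
def stretchedPrefactor (a b d e f : ℝ) : ℝ :=
  (-1 : ℝ) ^ (a + d - e) *
    (triangleCoeff (a + b + f) e d /
      (triangleCoeff a d e * triangleCoeff b e d * triangleCoeff d e f)) *
    Real.sqrt (fac (2 * a) * fac (2 * b) * fac (2 * f) /
      ((2 * a + 2 * b + 1) * fac (2 * a + 2 * b + 2 * f + 1))) *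
    ((a + b + e + d + f + 1) / ((a + e + d + 1) * (b + e + d + 1) * (d + e + f + 1)))

end

/-! The sum over `x` defining the `9j` symbol collapses to `x = b + f` (`nineJ_eq_mul`), and there
each of the three `6j` symbols contains a stretched triad, so Racah's sum has one term
(`sixJ_of_stretched`). The `9j` symbol is thus a single product of factorials and triangle
coefficients. On the other side, the `₅F₄` is very well poised and terminates because `a + b` is a
natural number; Dougall's theorem sums it to a quotient of Pochhammer symbols
(`hypergeom_wellPoised`). `nineJ_stretched` matches the two products. The closed form is continuous
at `ν = 0`, which gives the case `n = 0`. -/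

open Nat (factorial)

/-! ### Triads, triangle coefficients and one-term Racah sums -/

/-- A triad is a triple whose three triangle defects are natural numbers. -/
theorem isTriad_iff (a b c : ℝ) :
    IsTriad a b c ↔ ∃ u v w : ℕ, a + b - c = u ∧ a - b + c = v ∧ -a + b + c = w := by
  constructor
  · rintro ⟨⟨k, hk⟩, ⟨l, hl⟩, ⟨m, hm⟩, ⟨s, hs⟩, h1, h2⟩
    obtain ⟨h3, h4⟩ := abs_le.1 h1
    have e1 : m ≤ s := by
      have : (m : ℝ) ≤ s := by linarith
      exact_mod_cast this
    have e2 : l ≤ s := by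
      have : (l : ℝ) ≤ s := by linarith
      exact_mod_cast this
    have e3 : k ≤ s := by
      have : (k : ℝ) ≤ s := by linarith
      exact_mod_cast this
    refine ⟨s - m, s - l, s - k, ?_, ?_, ?_⟩
    · rw [Nat.cast_sub e1]; linarith
    · rw [Nat.cast_sub e2]; linarith
    · rw [Nat.cast_sub e3]; linarith
  · rintro ⟨u, v, w, hu, hv, hw⟩
    have := u.cast_nonneg (α := ℝ)
    have := v.cast_nonneg (α := ℝ)
    have := w.cast_nonneg (α := ℝ)
    refine ⟨⟨u + v, ?_⟩, ⟨u + w, ?_⟩, ⟨v + w, ?_⟩, ⟨u + v + w, ?_⟩, abs_le.2 ⟨?_, ?_⟩, ?_⟩ <;>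
      push_cast <;> linarith

theorem fac_eq_factorial {x : ℝ} {m : ℕ} (h : x = m) : fac x = (factorial m : ℝ) := by
  rw [fac, h, Real.Gamma_nat_eq_factorial]

theorem triangleCoeff_eq {a b c : ℝ} {u v w : ℕ} (hu : a + b - c = u) (hv : a - b + c = v)
    (hw : -a + b + c = w) :
    triangleCoeff a b c =
      √((factorial u * factorial v * factorial w : ℝ) / factorial (u + v + w + 1)) := by
  rw [triangleCoeff, fac_eq_factorial hu, fac_eq_factorial hv, fac_eq_factorial hw,
    fac_eq_factorial (m := u + v + w + 1) (by push_cast; linarith)]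

theorem triangleCoeff_rotate (a b c : ℝ) : triangleCoeff b c a = triangleCoeff a b c := by
  unfold triangleCoeff
  rw [show b + c - a = -a + b + c by ring, show b - c + a = a + b - c by ring,
    show -b + c + a = a - b + c by ring, show b + c + a + 1 = a + b + c + 1 by ring]
  congr 2
  ring

theorem IsTriad.bounds {a b c : ℝ} (h : IsTriad a b c) : a ≤ b + c ∧ b ≤ a + c ∧ c ≤ a + b := by
  obtain ⟨h1, h2⟩ := abs_le.1 h.lower
  exact ⟨by linarith, by linarith, h.upper⟩

theorem IsTriad.triangleCoeff_pos {a b c : ℝ} (h : IsTriad a b c) : 0 < triangleCoeff a b c := by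
  obtain ⟨u, v, w, hu, hv, hw⟩ := (isTriad_iff a b c).1 h
  rw [triangleCoeff_eq hu hv hw]
  have := fun m : ℕ => Nat.cast_pos (α := ℝ).2 m.factorial_pos
  exact Real.sqrt_pos.2 (div_pos (mul_pos (mul_pos (this _) (this _)) (this _)) (this _))

/-- Racah's sum has a single term for a stretched triad `c = a + b` or `e = a + f`. -/
theorem sixJ_of_stretched {a b c d e f : ℝ} (h1 : IsTriad a b c) (h2 : IsTriad a e f)
    (h3 : IsTriad d b f) (h4 : IsTriad d e c) {t : ℕ} (ht : d + e + c = t)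
    (hs : c = a + b ∨ e = a + f) :
    sixJ a b c d e f =
      triangleCoeff a b c * triangleCoeff a e f * triangleCoeff d b f * triangleCoeff d e c *
      ((-1 : ℝ) ^ t * fac ((t : ℝ) + 1) /
          (fac (t - (a + b + c)) * fac (t - (a + e + f)) *
            fac (t - (d + b + f)) * fac (t - (d + e + c)) *
            fac (a + b + d + e - t) * fac (b + c + e + f - t) * fac (c + a + f + d - t))) := by
  obtain ⟨x1, x2, x3⟩ := h1.bounds
  obtain ⟨y1, y2, y3⟩ := h2.bounds
  obtain ⟨z1, z2, z3⟩ := h3.bounds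
  obtain ⟨w1, w2, w3⟩ := h4.bounds
  rw [sixJ, if_pos ⟨h1, h2, h3, h4⟩]
  congr 1
  apply Finset.sum_eq_single_of_mem
  · simp only [Finset.mem_filter, Finset.mem_range, Nat.lt_succ_iff]
    refine ⟨Nat.le_floor ?_, ?_, ?_, ?_, ?_, ?_, ?_, ?_⟩ <;> rcases hs with hs | hs <;> linarith
  · intro k hk hne
    simp only [Finset.mem_filter] at hk
    obtain ⟨-, -, -, -, k1, k2, k3, k4⟩ := hk
    exfalso
    apply hne
    -- The lower bound `d + e + c` meets the upper bound `a + b + d + e` if `c = a + b`, and `c + a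
    -- + f + d` if `e = a + f`.
    have : (k : ℝ) = t := by rcases hs with hs | hs <;> linarith
    exact_mod_cast this

/-! ### Dougall's sum -/

section Dougall

/-- The summand of the terminating very well poised series, without the factor `(a + 2k) / a`. -/
noncomputable def wellPoisedTerm (a x y : ℝ) (n k : ℕ) : ℝ :=
  (ascPochhammer ℝ k).eval a * (ascPochhammer ℝ k).eval (-x) * (ascPochhammer ℝ k).eval (-y) *
      (ascPochhammer ℝ k).eval (-(n : ℝ)) /
    ((ascPochhammer ℝ k).eval (x + a + 1) * (ascPochhammer ℝ k).eval (y + a + 1) *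
      (ascPochhammer ℝ k).eval (n + a + 1) * (factorial k : ℝ))

theorem ascPochhammer_eval_succ_left (k : ℕ) (x : ℝ) :
    (ascPochhammer ℝ (k + 1)).eval x = x * (ascPochhammer ℝ k).eval (x + 1) := by
  simp [ascPochhammer_succ_left, Polynomial.eval_comp]

variable {a x y : ℝ}

theorem wellPoisedTerm_succ_right (a x y : ℝ) (n k : ℕ) :
    wellPoisedTerm a x y n (k + 1) = wellPoisedTerm a x y n k *
      ((a + k) * (k - x) * (k - y) * (k - n) /
        ((x + a + 1 + k) * (y + a + 1 + k) * (n + a + 1 + k) * (k + 1))) := by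
  unfold wellPoisedTerm
  simp only [ascPochhammer_succ_eval, Nat.factorial_succ]
  rw [div_mul_div_comm]
  push_cast
  congr 1 <;> ring

/-- Since `(-n-1)_{k+1} = -(n+1) (-n)_k`, raising `n` and `k` together has a well-defined ratio;
raising `n` alone would divide by `n + 1 - k`, which vanishes at `k = n + 1`. -/
theorem wellPoisedTerm_succ_succ (ha : -1 < a) (x y : ℝ) (n k : ℕ) :
    wellPoisedTerm a x y (n + 1) (k + 1) = wellPoisedTerm a x y n k *
      ((a + k) * (k - x) * (k - y) * (-(n + 1)) * (n + a + 1) /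
        ((x + a + 1 + k) * (y + a + 1 + k) * ((n + a + 1 + k) * (n + a + 2 + k)) * (k + 1))) := by
  have hn : (0 : ℝ) < n + a + 1 := by have := n.cast_nonneg (α := ℝ); linarith
  have hP : (ascPochhammer ℝ (k + 1)).eval ((n : ℝ) + a + 1 + 1) =
      (ascPochhammer ℝ k).eval ((n : ℝ) + a + 1) * ((n + a + 1 + k) * (n + a + 2 + k)) /
        (n + a + 1) := by
    rw [eq_div_iff hn.ne', mul_comm, ← ascPochhammer_eval_succ_left, ascPochhammer_succ_eval,
      ascPochhammer_succ_eval]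
    push_cast
    ring
  unfold wellPoisedTerm
  rw [show (((n + 1 : ℕ) : ℝ) + a + 1) = (n : ℝ) + a + 1 + 1 by push_cast; ring, hP,
    ascPochhammer_eval_succ_left k (-((n + 1 : ℕ) : ℝ)),
    show (-((n + 1 : ℕ) : ℝ) + 1) = -(n : ℝ) by push_cast; ring]
  simp only [ascPochhammer_succ_eval, Nat.factorial_succ]
  rw [div_mul_div_comm, mul_div_assoc', div_mul_eq_mul_div, div_div_eq_mul_div]
  push_cast
  congr 1 <;> ring

/-- The partial sums of the difference between consecutive terminating series telescope. -/
theorem sum_wellPoised_telescope (ha : -1 < a) (hx : 0 ≤ x) (hy : 0 ≤ y) (n K : ℕ) :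
    ∑ k ∈ Finset.range (K + 1), ((x + a + 1 + n) * (y + a + 1 + n) * (a + 2 * k) *
        wellPoisedTerm a x y (n + 1) k -
      (a + 1 + n) * (x + y + a + 1 + n) * (a + 2 * k) * wellPoisedTerm a x y n k) =
      (a + 1 + n) * ((a + K) * (K - x) * (K - y) / (n + a + 1 + K)) *
        wellPoisedTerm a x y n K := by
  have hn := n.cast_nonneg (α := ℝ)
  induction K with
  | zero =>
    have : (n : ℝ) + a + 1 ≠ 0 := by linarith
    simp [wellPoisedTerm]
    field_simp
    ring
  | succ k ih =>
    have hk := k.cast_nonneg (α := ℝ)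
    rw [Finset.sum_range_succ, ih, wellPoisedTerm_succ_succ ha,
      wellPoisedTerm_succ_right a x y n k]
    have h1 : x + a + 1 + k ≠ 0 := by linarith
    have h2 : y + a + 1 + k ≠ 0 := by linarith
    have h3 : (n : ℝ) + a + 1 + k ≠ 0 := by linarith
    have h4 : (n : ℝ) + a + 2 + k ≠ 0 := by linarith
    have h6 : (n : ℝ) + a + 1 + (k + 1) ≠ 0 := by linarith
    have h5 : (k : ℝ) + 1 ≠ 0 := by linarith
    push_cast
    generalize wellPoisedTerm a x y n k = W
    rw [show (n : ℝ) + a + 1 + (k + 1) = n + a + 2 + k by ring]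
    field_simp
    ring

theorem wellPoisedTerm_eq_zero {n k : ℕ} (h : n < k) : wellPoisedTerm a x y n k = 0 := by
  simp [wellPoisedTerm, ascPochhammer_eval_neg_coe_nat_of_lt h]

/-- Dougall's sum of the terminating very well poised `₅F₄` at `1`. -/
theorem sum_wellPoised (ha : -1 < a) (hx : 0 ≤ x) (hy : 0 ≤ y) (n : ℕ) :
    ∑ k ∈ Finset.range (n + 1), (a + 2 * k) * wellPoisedTerm a x y n k =
      a * ((ascPochhammer ℝ n).eval (a + 1) * (ascPochhammer ℝ n).eval (x + y + a + 1) /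
        ((ascPochhammer ℝ n).eval (x + a + 1) * (ascPochhammer ℝ n).eval (y + a + 1))) := by
  induction n with
  | zero => simp [wellPoisedTerm]
  | succ n ih =>
    have hn := n.cast_nonneg (α := ℝ)
    -- At `K = n + 1` the right side contains `(-n)_{n+1} = 0`. What remains is a first-order
    -- recurrence in `n`, whose coefficients are the next factors of the four Pochhammer symbols.
    have h := sum_wellPoised_telescope ha hx hy n (n + 1)
    rw [wellPoisedTerm_eq_zero (Nat.lt_succ_self n), mul_zero, Finset.sum_sub_distrib,
      Finset.sum_range_succ (fun k : ℕ => (a + 1 + n) * (x + y + a + 1 + n) * (a + 2 * (k : ℝ)) *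
        wellPoisedTerm a x y n k), wellPoisedTerm_eq_zero (Nat.lt_succ_self n), mul_zero,
      add_zero] at h
    simp only [mul_assoc _ (a + 2 * (_ : ℝ)), ← Finset.mul_sum] at h
    rw [ih] at h
    simp only [ascPochhammer_succ_eval]
    have h1 : x + a + 1 + n ≠ 0 := by linarith
    have h2 : y + a + 1 + n ≠ 0 := by linarith
    have h3 := (ascPochhammer_pos n (x + a + 1) (by linarith)).ne'
    have h4 := (ascPochhammer_pos n (y + a + 1) (by linarith)).ne'
    have h5 := sub_eq_zero.1 h
    rw [← mul_right_inj' (mul_ne_zero h1 h2), h5]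
    field_simp

/-- The quotient `(a/2+1)_k / (a/2)_k` collapses to `(a + 2k) / a`. At `a = 0` both `(a)_k` and
`(a/2)_k` vanish for `k ≥ 1`, hence the exclusion. Allowing `-1 < a < 0` serves the two-sided limit.
-/
theorem hypergeom_wellPoised (ha : -1 < a) (ha0 : a ≠ 0) (hx : 0 ≤ x) (hy : 0 ≤ y) (n : ℕ) :
    hypergeom [a / 2 + 1, a, -x, -y, -(n : ℝ)] [a / 2, x + a + 1, y + a + 1, n + a + 1] 1 =
      (ascPochhammer ℝ n).eval (a + 1) * (ascPochhammer ℝ n).eval (x + y + a + 1) /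
        ((ascPochhammer ℝ n).eval (x + a + 1) * (ascPochhammer ℝ n).eval (y + a + 1)) := by
  have key (k : ℕ) : (ascPochhammer ℝ k).eval (a / 2 + 1) / (ascPochhammer ℝ k).eval (a / 2) =
      (a + 2 * k) / a := by
    have h1 : (ascPochhammer ℝ k).eval (a / 2) ≠ 0 := by
      cases k with
      | zero => simp
      | succ k =>
        rw [ascPochhammer_eval_succ_left]
        exact mul_ne_zero (by simpa using ha0) (ascPochhammer_pos k _ (by linarith)).ne'
    rw [div_eq_div_iff h1 ha0]
    have := ascPochhammer_eval_succ_left k (a / 2)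
    rw [ascPochhammer_succ_eval] at this
    linear_combination -2 * this
  have hterm (k : ℕ) : ([a / 2 + 1, a, -x, -y, -(n : ℝ)].map
        fun a => (ascPochhammer ℝ k).eval a).prod /
      ([a / 2, x + a + 1, y + a + 1, n + a + 1].map
        fun b => (ascPochhammer ℝ k).eval b).prod * 1 ^ k / (k.factorial : ℝ) =
      (a + 2 * k) * wellPoisedTerm a x y n k / a := by
    simp only [List.map_cons, List.map_nil, List.prod_cons, List.prod_nil, one_pow, mul_one]
    rw [mul_div_right_comm (a + 2 * (k : ℝ)), ← key k, wellPoisedTerm, div_mul_div_comm, div_div]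
    congr 1 <;> ring
  rw [hypergeom, tsum_congr hterm, tsum_eq_sum (s := Finset.range (n + 1)),
    ← Finset.sum_div, sum_wellPoised ha hx hy, mul_div_cancel_left₀ _ ha0]
  intro k hk
  rw [wellPoisedTerm_eq_zero (by simpa using hk), mul_zero, zero_div]

end Dougall

/-! ### The three stretched `6j` symbols -/

theorem ascPochhammer_eval_natCast_add_one (m k : ℕ) :
    (ascPochhammer ℝ k).eval ((m : ℝ) + 1) = (factorial (m + k) : ℝ) / factorial m := by
  have h := Nat.factorial_mul_ascFactorial m k
  rw [eq_div_iff (by positivity), ← h, ← ascPochhammer_nat_eq_ascFactorial, Nat.cast_mul,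
    ascPochhammer_eval_cast, Nat.cast_add_one, mul_comm]

theorem sixJ_eq_zero {a b c d e f : ℝ}
    (h : ¬(IsTriad a b c ∧ IsTriad a e f ∧ IsTriad d b f ∧ IsTriad d e c)) :
    sixJ a b c d e f = 0 := if_neg h

theorem triangleCoeff_sq {a b c : ℝ} {u v w : ℕ} (hu : a + b - c = u) (hv : a - b + c = v)
    (hw : -a + b + c = w) :
    triangleCoeff a b c ^ 2 =
      (factorial u * factorial v * factorial w : ℝ) / factorial (u + v + w + 1) := by
  rw [triangleCoeff_eq hu hv hw, Real.sq_sqrt (by positivity)]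

/-- The stretched triad is `(a, i, x)`. The natural numbers are triangle defects, so every factorial
in Racah's single term becomes a natural one. -/
theorem sixJ_first {a d e i x : ℝ} {p p' X n : ℕ} (hp : a + d - e = p) (hp' : a - d + e = p')
    (hX : x = X) (hn : e + d - a - x = n) (hi : i = a + x) :
    sixJ a d e d i x =
      triangleCoeff a d e * triangleCoeff a i x * triangleCoeff d d x * triangleCoeff i e d *
        ((-1) ^ (n + (p + p') + 2 * X) * (factorial (n + (p + p') + 2 * X + 1) : ℝ) /
          (factorial X * factorial n * factorial p' * factorial p * factorial X)) := by
  have t1 : IsTriad a d e :=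
    (isTriad_iff _ _ _).2 ⟨p, p', n + X, by linarith, by linarith, by push_cast; linarith⟩
  have t2 : IsTriad a i x :=
    (isTriad_iff _ _ _).2 ⟨p + p', 0, 2 * X, by push_cast; linarith, by push_cast; linarith, by push_cast; linarith⟩
  have t3 : IsTriad d d x :=
    (isTriad_iff _ _ _).2 ⟨n + p, X, X, by push_cast; linarith, by linarith, by linarith⟩
  have t4 : IsTriad d i e :=
    (isTriad_iff _ _ _).2 ⟨p + X, n, p' + X, by push_cast; linarith, by linarith, by push_cast; linarith⟩
  rw [sixJ_of_stretched t1 t2 t3 t4 (t := n + (p + p') + 2 * X) (by push_cast; linarith) (Or.inr hi),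
    ← triangleCoeff_rotate d i e,
    fac_eq_factorial (x := ((n + (p + p') + 2 * X : ℕ) : ℝ) + 1) (m := n + (p + p') + 2 * X + 1) (by push_cast; linarith),
    fac_eq_factorial (x := ((n + (p + p') + 2 * X : ℕ) : ℝ) - (a + d + e)) (m := X) (by push_cast; linarith),
    fac_eq_factorial (x := ((n + (p + p') + 2 * X : ℕ) : ℝ) - (a + i + x)) (m := n) (by push_cast; linarith),
    fac_eq_factorial (x := ((n + (p + p') + 2 * X : ℕ) : ℝ) - (d + d + x)) (m := p') (by push_cast; linarith),
    fac_eq_factorial (x := ((n + (p + p') + 2 * X : ℕ) : ℝ) - (d + i + e)) (m := 0) (by push_cast; linarith),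
    fac_eq_factorial (x := a + d + d + i - ((n + (p + p') + 2 * X : ℕ) : ℝ)) (m := p) (by push_cast; linarith),
    fac_eq_factorial (x := d + e + i + x - ((n + (p + p') + 2 * X : ℕ) : ℝ)) (m := X) (by push_cast; linarith),
    fac_eq_factorial (x := e + a + x + d - ((n + (p + p') + 2 * X : ℕ) : ℝ)) (m := 0) (by push_cast; linarith)]
  simp only [Nat.factorial_zero, Nat.cast_one, mul_one]

theorem sixJ_second {b d e f x : ℝ} {q q' r r' m X : ℕ} (h_bed : IsTriad b e d)
    (h_def : IsTriad d e f) (hq : b + e - d = q) (hq' : b - e + d = q')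
    (hr : d - e + f = r) (hr' : -d + e + f = r') (hX : x = X) (hm : 2 * d - x = m)
    (hx : x = b + f) :
    sixJ b e d d x f =
      triangleCoeff b e d * triangleCoeff b x f * triangleCoeff d e f * triangleCoeff d d x *
        ((-1) ^ (m + 2 * X) * (factorial (m + 2 * X + 1) : ℝ) /
          (factorial r * factorial m * factorial q' * factorial q * factorial r')) := by
  have t2 : IsTriad b x f :=
    (isTriad_iff _ _ _).2 ⟨q + q', 0, r + r', by push_cast; linarith, by push_cast; linarith, by push_cast; linarith⟩
  have t4 : IsTriad d x d :=
    (isTriad_iff _ _ _).2 ⟨X, m, X, by linarith, by linarith, by linarith⟩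
  rw [sixJ_of_stretched h_bed t2 h_def t4 (t := m + 2 * X) (by push_cast; linarith) (Or.inr hx),
    show triangleCoeff d x d = triangleCoeff d d x from triangleCoeff_rotate d d x,
    fac_eq_factorial (x := ((m + 2 * X : ℕ) : ℝ) + 1) (m := m + 2 * X + 1) (by push_cast; linarith),
    fac_eq_factorial (x := ((m + 2 * X : ℕ) : ℝ) - (b + e + d)) (m := r) (by push_cast; linarith),
    fac_eq_factorial (x := ((m + 2 * X : ℕ) : ℝ) - (b + x + f)) (m := m) (by push_cast; linarith),
    fac_eq_factorial (x := ((m + 2 * X : ℕ) : ℝ) - (d + e + f)) (m := q') (by push_cast; linarith),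
    fac_eq_factorial (x := ((m + 2 * X : ℕ) : ℝ) - (d + x + d)) (m := 0) (by push_cast; linarith),
    fac_eq_factorial (x := b + e + d + x - ((m + 2 * X : ℕ) : ℝ)) (m := q) (by push_cast; linarith),
    fac_eq_factorial (x := e + d + x + f - ((m + 2 * X : ℕ) : ℝ)) (m := r') (by push_cast; linarith),
    fac_eq_factorial (x := d + b + f + d - ((m + 2 * X : ℕ) : ℝ)) (m := 0) (by push_cast; linarith)]
  simp only [Nat.factorial_zero, Nat.cast_one, mul_one]

/-- All four triads are stretched, so four of the seven denominator factorials are `0!`. -/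
theorem sixJ_third {a b f i x z : ℝ} {A B F X : ℕ} (hA : 2 * a = A) (hB : 2 * b = B)
    (hF : 2 * f = F) (hX : x = X) (hx : x = b + f) (hz : z = a + b) (hi : i = z + f) :
    sixJ z f i x a b =
      triangleCoeff z f i * triangleCoeff z a b * triangleCoeff b x f * triangleCoeff a i x *
        ((-1) ^ (A + 2 * X) * (factorial (A + 2 * X + 1) : ℝ) /
          (factorial F * factorial A * factorial B)) := by
  have t1 : IsTriad z f i :=
    (isTriad_iff _ _ _).2 ⟨0, A + B, F, by push_cast; linarith, by push_cast; linarith, by linarith⟩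
  have t2 : IsTriad z a b :=
    (isTriad_iff _ _ _).2 ⟨A, B, 0, by linarith, by linarith, by push_cast; linarith⟩
  have t3 : IsTriad x f b :=
    (isTriad_iff _ _ _).2 ⟨F, B, 0, by linarith, by linarith, by push_cast; linarith⟩
  have t4 : IsTriad x a i :=
    (isTriad_iff _ _ _).2 ⟨0, 2 * X, A, by push_cast; linarith, by push_cast; linarith, by linarith⟩
  rw [sixJ_of_stretched t1 t2 t3 t4 (t := A + 2 * X) (by push_cast; linarith) (Or.inl hi),
    show triangleCoeff x f b = triangleCoeff b x f from triangleCoeff_rotate b x f,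
    show triangleCoeff x a i = triangleCoeff a i x from
      (triangleCoeff_rotate x a i).symm,
    fac_eq_factorial (x := ((A + 2 * X : ℕ) : ℝ) + 1) (m := A + 2 * X + 1) (by push_cast; linarith),
    fac_eq_factorial (x := ((A + 2 * X : ℕ) : ℝ) - (z + f + i)) (m := 0) (by push_cast; linarith),
    fac_eq_factorial (x := ((A + 2 * X : ℕ) : ℝ) - (z + a + b)) (m := F) (by push_cast; linarith),
    fac_eq_factorial (x := ((A + 2 * X : ℕ) : ℝ) - (x + f + b)) (m := A) (by push_cast; linarith),
    fac_eq_factorial (x := ((A + 2 * X : ℕ) : ℝ) - (x + a + i)) (m := 0) (by push_cast; linarith),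
    fac_eq_factorial (x := z + f + x + a - ((A + 2 * X : ℕ) : ℝ)) (m := 0) (by push_cast; linarith),
    fac_eq_factorial (x := f + i + a + b - ((A + 2 * X : ℕ) : ℝ)) (m := 0) (by push_cast; linarith),
    fac_eq_factorial (x := i + z + b + x - ((A + 2 * X : ℕ) : ℝ)) (m := B) (by push_cast; linarith)]
  simp only [Nat.factorial_zero, Nat.cast_one, mul_one, one_mul]

/-- These two coefficients occur only in the third `6j` symbol and supply the square root in `P`;
`(2a+2b)!` cancels, leaving `2a + 2b + 1`. -/
theorem triangleCoeff_mul_stretched {a b f i z : ℝ} {A B F : ℕ} (hA : 2 * a = A)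
    (hB : 2 * b = B) (hF : 2 * f = F) (hz : z = a + b) (hi : i = z + f) :
    triangleCoeff z f i * triangleCoeff z a b =
      √(fac (2 * a) * fac (2 * b) * fac (2 * f) /
        ((2 * a + 2 * b + 1) * fac (2 * a + 2 * b + 2 * f + 1))) := by
  rw [triangleCoeff_eq (a := z) (b := f) (c := i) (u := 0) (v := A + B) (w := F) (by push_cast; linarith) (by push_cast; linarith) (by linarith),
    triangleCoeff_eq (a := z) (b := a) (c := b) (u := A) (v := B) (w := 0) (by linarith) (by linarith) (by push_cast; linarith),
    ← Real.sqrt_mul (by positivity), fac_eq_factorial hA, fac_eq_factorial hB,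
    fac_eq_factorial hF, hA, hB, fac_eq_factorial (m := A + B + F + 1) (by push_cast; linarith)]
  congr 1
  rw [add_zero, Nat.factorial_succ (A + B), zero_add]
  push_cast [Nat.factorial_zero]
  field_simp

/-! ### Assembling the `9j` symbol -/

/-- The triad `(a, a+b+f, x)` forces `x ≥ b + f`, and `(b, x, f)` forces `x ≤ b + f`. The sign is
`+` because `b + f` is an integer. -/
theorem nineJ_eq_mul {a b d e f : ℝ} {X : ℕ} (hX : b + f = X) (ha : 0 ≤ a) :
    nineJ a b (a + b) d e f e d (a + b + f) =
      (2 * (X : ℝ) + 1) * sixJ a d e d (a + b + f) (b + f) * sixJ b e d d (b + f) f *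
        sixJ (a + b) f (a + b + f) (b + f) a b := by
  rw [nineJ, Finset.sum_eq_single_of_mem (2 * X)]
  · rw [show ((2 * X : ℕ) : ℝ) / 2 = b + f by push_cast; linarith, pow_mul, ← hX]
    simp
  · rw [Finset.mem_range, Nat.lt_succ_iff]
    apply Nat.le_floor
    push_cast
    linarith
  · intro k _ hk
    by_cases h1 : IsTriad a (a + b + f) (k / 2)
    · by_cases h2 : IsTriad b (k / 2) f
      · exfalso
        apply hk
        have h3 := h1.bounds
        have h4 := h2.bounds
        have : (k : ℝ) = (2 * X : ℕ) := by push_cast; linarith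
        exact_mod_cast this
      · rw [sixJ_eq_zero (a := b) (by tauto)]
        ring
    · rw [sixJ_eq_zero (a := a) (by tauto)]
      ring

-- The factorial bookkeeping with opaque nonzero letters: the six squared triangle coefficients
-- times the three Racah terms, against the rational factor of `P` times Dougall's quotient.
set_option maxHeartbeats 1000000 in
theorem stretched_cancellation {P P' Q Q' R R' x y z A B F K I M x₀ m T n u ka kb kf wa wb wf : ℝ}
    (l ε₁ ε₂ ε₃ D E : ℝ)
    (hP : P ≠ 0) (hP' : P' ≠ 0) (hQ : Q ≠ 0) (hQ' : Q' ≠ 0) (hR : R ≠ 0) (hR' : R' ≠ 0)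
    (hx : x ≠ 0) (hy : y ≠ 0) (hA : A ≠ 0) (hB : B ≠ 0) (hF : F ≠ 0)
    (hK : K ≠ 0) (hI : I ≠ 0) (hM : M ≠ 0) (hx₀ : x₀ ≠ 0) (hm : m ≠ 0) (hn : n ≠ 0)
    (hu : u ≠ 0) (hka : ka ≠ 0) (hkb : kb ≠ 0) (hkf : kf ≠ 0) (hwa : wa ≠ 0) (hwb : wb ≠ 0)
    (hwf : wf ≠ 0) :
    u * (P * P' * x / (ka * wa) * (Q * Q' * y / (kb * wb)) * (z * R * R' / (kf * wf)) *
        (A * 1 * K / I) * (m * x₀ * x₀ / M) * (B * 1 * F / (u * K))) *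
      (ε₁ * (l * T) / (x₀ * n * P' * P * x₀) * (ε₂ * M / (R * m * Q' * Q * R')) *
        (ε₃ * I / (F * A * B))) * D * E =
    ε₁ * ε₂ * ε₃ * D * E * (l / (ka * kb * kf)) *
      (z / n * (T / wf) / (wb / x * (wa / y))) := by
  have e1 : u * (P * P' * x / (ka * wa) * (Q * Q' * y / (kb * wb)) * (z * R * R' / (kf * wf)) *
        (A * 1 * K / I) * (m * x₀ * x₀ / M) * (B * 1 * F / (u * K))) =
      P * P' * Q * Q' * R * R' * A * B * F * m * x₀ ^ 2 * x * y * z /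
        (ka * wa * kb * wb * kf * wf * I * M) := by
    field_simp
  have e2 : ε₁ * (l * T) / (x₀ * n * P' * P * x₀) * (ε₂ * M / (R * m * Q' * Q * R')) *
        (ε₃ * I / (F * A * B)) = ε₁ * ε₂ * ε₃ * l * T * M * I /
          (n * (P * P' * Q * Q' * R * R' * A * B * F * m * x₀ ^ 2)) := by
    rw [div_mul_div_comm, div_mul_div_comm]
    congr 1 <;> ring
  rw [e1, e2]
  have hS : P * P' * Q * Q' * R * R' * A * B * F * m * x₀ ^ 2 ≠ 0 := by positivity
  -- This product, common to squares and Racah terms, cancels as one letter.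
  generalize P * P' * Q * Q' * R * R' * A * B * F * m * x₀ ^ 2 = S at *
  field_simp

/-- The `9j` symbol as a prefactor times Dougall's closed form of the `₅F₄`. -/
theorem nineJ_stretched {a b d e f : ℝ}
    (h_ade : IsTriad a d e) (h_bed : IsTriad b e d) (h_def : IsTriad d e f)
    {X Y Z n : ℕ} (hX : b + f = X) (hY : a + f = Y)
    (hZ : a + b = Z) (hn : e + d - a - b - f = n) :
    nineJ a b (a + b) d e f e d (a + b + f) =
      stretchedPrefactor a b d e f *
        ((ascPochhammer ℝ Z).eval ((n : ℝ) + 1) * (ascPochhammer ℝ Z).eval ((X : ℝ) + Y + n + 1) /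
        ((ascPochhammer ℝ Z).eval ((X : ℝ) + n + 1) *
          (ascPochhammer ℝ Z).eval ((Y : ℝ) + n + 1))) := by
  have p1 := h_ade.triangleCoeff_pos.ne'
  have p2 := h_bed.triangleCoeff_pos.ne'
  have p3 := h_def.triangleCoeff_pos.ne'
  obtain ⟨p, p', -, hp, hp', -⟩ := (isTriad_iff _ _ _).1 h_ade
  obtain ⟨q, q', -, hq, hq', -⟩ := (isTriad_iff _ _ _).1 h_bed
  obtain ⟨-, r, r', -, hr, hr'⟩ := (isTriad_iff _ _ _).1 h_def
  have hA : 2 * a = (p + p' : ℕ) := by push_cast; linarith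
  have hB : 2 * b = (q + q' : ℕ) := by push_cast; linarith
  have hF : 2 * f = (r + r' : ℕ) := by push_cast; linarith
  have d1 := triangleCoeff_sq hp hp' (show -a + d + e = (n + X : ℕ) by push_cast; linarith)
  have d2 := triangleCoeff_sq hq hq' (show -b + e + d = (n + Y : ℕ) by push_cast; linarith)
  have d3 := triangleCoeff_sq (show d + e - f = (n + Z : ℕ) by push_cast; linarith) hr hr'
  have d4 := triangleCoeff_sq (a := a) (b := a + b + f) (c := b + f) (u := p + p') (v := 0)
    (w := 2 * X) (by push_cast; linarith) (by push_cast; linarith) (by push_cast; linarith)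
  have d5 := triangleCoeff_sq (a := d) (b := d) (c := b + f) (u := n + p) (v := X)
    (w := X) (by push_cast; linarith) (by linarith) (by linarith)
  have d6 := triangleCoeff_sq (a := b) (b := b + f) (c := f) (u := q + q') (v := 0)
    (w := r + r') (by push_cast; linarith) (by push_cast; linarith) (by push_cast; linarith)
  have n0 : q + q' + 0 + (r + r') = 2 * X := by
    have : ((q + q' + 0 + (r + r') : ℕ) : ℝ) = (2 * X : ℕ) := by push_cast; linarith
    exact_mod_cast this
  -- The sums are `b + d + e`, `a + d + e`, `d + e + f` and `a + b + d + e + f`: the Pochhammer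
  -- factorials are those of the triangle coefficients and the first Racah term.
  have n1 : n + X + Z = q + q' + (n + Y) := by
    have : ((n + X + Z : ℕ) : ℝ) = (q + q' + (n + Y) : ℕ) := by push_cast; linarith
    exact_mod_cast this
  have n2 : n + Y + Z = p + p' + (n + X) := by
    have : ((n + Y + Z : ℕ) : ℝ) = (p + p' + (n + X) : ℕ) := by push_cast; linarith
    exact_mod_cast this
  have n3 : n + X + Y = n + Z + r + r' := by
    have : ((n + X + Y : ℕ) : ℝ) = (n + Z + r + r' : ℕ) := by push_cast; linarith
    exact_mod_cast this
  have n4 : X + Y + n + Z = n + (p + p') + 2 * X := by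
    have : ((X + Y + n + Z : ℕ) : ℝ) = (n + (p + p') + 2 * X : ℕ) := by push_cast; linarith
    exact_mod_cast this
  have hsign : (-1 : ℝ) ^ (n + (p + p') + 2 * X) * (-1) ^ (n + p + 2 * X) *
      (-1) ^ (p + p' + 2 * X) = (-1) ^ p := by
    rw [← pow_add, ← pow_add, show n + (p + p') + 2 * X + (n + p + 2 * X) + (p + p' + 2 * X) =
      p + 2 * (n + p + p' + 3 * X) by ring, pow_add, pow_mul]
    simp
  have a1 : a + b + e + d + f + 1 = ((n + (p + p') + 2 * X : ℕ) : ℝ) + 1 := by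
    push_cast; linarith
  have a2 : a + e + d + 1 = ((p + p' + (n + X) : ℕ) : ℝ) + 1 := by push_cast; linarith
  have a3 : b + e + d + 1 = ((q + q' + (n + Y) : ℕ) : ℝ) + 1 := by push_cast; linarith
  have a4 : d + e + f + 1 = ((n + Z + r + r' : ℕ) : ℝ) + 1 := by push_cast; linarith
  rw [nineJ_eq_mul hX (by linarith [(p + p').cast_nonneg (α := ℝ)]),
    sixJ_first hp hp' hX (n := n) (by linarith) (by ring),
    sixJ_second h_bed h_def hq hq' hr hr' hX (m := n + p) (by push_cast; linarith) rfl,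
    sixJ_third hA hB hF hX rfl rfl rfl, stretchedPrefactor, hp, Real.rpow_natCast, ← hsign,
    ← triangleCoeff_mul_stretched hA hB hF rfl rfl, a1, a2, a3, a4,
    ascPochhammer_eval_natCast_add_one,
    show (X : ℝ) + Y + n + 1 = ((X + Y + n : ℕ) : ℝ) + 1 by push_cast; ring,
    show (X : ℝ) + n + 1 = ((n + X : ℕ) : ℝ) + 1 by push_cast; ring,
    show (Y : ℝ) + n + 1 = ((n + Y : ℕ) : ℝ) + 1 by push_cast; ring,
    ascPochhammer_eval_natCast_add_one, ascPochhammer_eval_natCast_add_one,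
    ascPochhammer_eval_natCast_add_one, n1, n2, n4, show X + Y + n = n + Z + r + r' by omega]
  rw [Nat.factorial_succ] at d1 d2 d3
  rw [n0, Nat.factorial_succ (2 * X)] at d6
  rw [add_zero] at d4
  rw [show n + p + X + X + 1 = n + p + 2 * X + 1 by ring] at d5
  rw [Nat.factorial_succ (n + (p + p') + 2 * X)]
  push_cast [Nat.factorial_zero] at d1 d2 d3 d4 d5 d6 ⊢
  generalize triangleCoeff (a + b) f (a + b + f) = D7 at *
  generalize triangleCoeff (a + b) a b = D8 at *
  generalize triangleCoeff (a + b + f) e d = D0 at *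
  generalize triangleCoeff a d e = D1 at *
  generalize triangleCoeff b e d = D2 at *
  generalize triangleCoeff d e f = D3 at *
  generalize triangleCoeff a (a + b + f) (b + f) = D4 at *
  generalize triangleCoeff d d (b + f) = D5 at *
  generalize triangleCoeff b (b + f) f = D6 at *
  generalize (-1 : ℝ) ^ (n + (p + p') + 2 * X) = ε₁
  generalize (-1 : ℝ) ^ (n + p + 2 * X) = ε₂
  generalize (-1 : ℝ) ^ (p + p' + 2 * X) = ε₃
  have g (m : ℕ) : (factorial m : ℝ) ≠ 0 := Nat.cast_ne_zero.2 m.factorial_ne_zero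
  -- `D` is the quotient of triangle coefficients in `P`. After this substitution `D1`, …, `D6`
  -- occur only squared on the left, so no root remains there outside `D`, `D7` and `D8`.
  obtain ⟨D, rfl⟩ : ∃ D, D0 = D * (D1 * D2 * D3) :=
    ⟨D0 / (D1 * D2 * D3), (div_mul_cancel₀ _ (mul_ne_zero (mul_ne_zero p1 p2) p3)).symm⟩
  rw [mul_div_cancel_right₀ _ (mul_ne_zero (mul_ne_zero p1 p2) p3)]
  have hL (S1 S2 S3 : ℝ) : (2 * (X : ℝ) + 1) * (D1 * D4 * D5 * (D * (D1 * D2 * D3)) * S1) *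
      (D2 * D6 * D3 * D5 * S2) * (D7 * D8 * D6 * D4 * S3) =
      (2 * (X : ℝ) + 1) * (D1 ^ 2 * D2 ^ 2 * D3 ^ 2 * D4 ^ 2 * D5 ^ 2 * D6 ^ 2) *
        (S1 * S2 * S3) * D * (D7 * D8) := by
    ring
  rw [hL, d1, d2, d3, d4, d5, d6]
  apply stretched_cancellation <;> first | exact g _ | positivity

/-! ### The theorem -/

theorem mainTheorem1 (a b d e f : ℝ)
    (h_ade : IsTriad a d e) (h_bed : IsTriad b e d) (h_def : IsTriad d e f)
    (h_row : IsTriad e d (a + b + f)) :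
    (e + d - a - b - f ≠ 0 →
      nineJ a b (a + b) d e f e d (a + b + f) =
        stretchedPrefactor a b d e f *
          hypergeom
            [(e + d - a - b - f) / 2 + 1, e + d - a - b - f, -b - f, -a - f, -a - b]
            [(e + d - a - b - f) / 2, e + d - a + 1, e + d - b + 1, e + d - f + 1] 1) ∧
    (e + d - a - b - f = 0 →
      Filter.Tendsto
        (fun n : ℝ =>
          stretchedPrefactor a b d e f *
            hypergeom
              [n / 2 + 1, n, -b - f, -a - f, -a - b]
              [n / 2, (b + f) + n + 1, (a + f) + n + 1, (a + b) + n + 1] 1)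
        (𝓝[≠] 0)
        (𝓝 (nineJ a b (a + b) d e f e d (a + b + f)))) := by
  obtain ⟨p, p', -, hp, hp', -⟩ := (isTriad_iff _ _ _).1 h_ade
  obtain ⟨q, q', -, hq, hq', -⟩ := (isTriad_iff _ _ _).1 h_bed
  obtain ⟨-, r, r', -, hr, hr'⟩ := (isTriad_iff _ _ _).1 h_def
  obtain ⟨n, -, -, hn, -, -⟩ := (isTriad_iff _ _ _).1 h_row
  have hX : b + f = (q + r : ℕ) := by push_cast; linarith
  have hY : a + f = (p + r' : ℕ) := by push_cast; linarith
  have hZ : a + b = (p + q : ℕ) := by push_cast; linarith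
  have hn' : e + d - a - b - f = n := by linarith
  have h9 := nineJ_stretched h_ade h_bed h_def hX hY hZ hn'
  generalize q + r = X at hX h9
  generalize p + r' = Y at hY h9
  generalize p + q = Z at hZ h9
  have hyp (ν : ℝ) (h1 : -1 < ν) (h0 : ν ≠ 0) :=
    hypergeom_wellPoised h1 h0 X.cast_nonneg Y.cast_nonneg Z
  rw [show -b - f = -(X : ℝ) by linarith, show -a - f = -(Y : ℝ) by linarith,
    show -a - b = -(Z : ℝ) by linarith]
  constructor
  · intro h0
    rw [h9, hn', show e + d - a + 1 = (X : ℝ) + n + 1 by linarith,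
      show e + d - b + 1 = (Y : ℝ) + n + 1 by linarith,
      show e + d - f + 1 = (Z : ℝ) + n + 1 by linarith,
      hyp n (by linarith [n.cast_nonneg (α := ℝ)]) (hn' ▸ h0)]
  · intro h0
    obtain rfl : n = 0 := by exact_mod_cast hn'.symm.trans h0
    rw [h9, hX, hY, hZ]
    refine Filter.Tendsto.const_mul _ ?_
    have hpos (x : ℝ) (hx : 0 ≤ x) : (ascPochhammer ℝ Z).eval (x + (0 : ℕ) + 1) ≠ 0 :=
      (ascPochhammer_pos Z _ (by push_cast; linarith)).ne'
    -- Continuity is that of the closed form; the series agrees with it only on `ν ≠ 0`, `ν > -1`,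
    -- which suffices for the punctured limit.
    have hcont : ContinuousAt (fun ν : ℝ => (ascPochhammer ℝ Z).eval (ν + 1) *
        (ascPochhammer ℝ Z).eval ((X : ℝ) + Y + ν + 1) /
        ((ascPochhammer ℝ Z).eval ((X : ℝ) + ν + 1) *
          (ascPochhammer ℝ Z).eval ((Y : ℝ) + ν + 1))) ((0 : ℕ) : ℝ) := by
      refine ContinuousAt.div ?_ ?_
        (mul_ne_zero (hpos X X.cast_nonneg) (hpos Y Y.cast_nonneg)) <;>
      exact Continuous.continuousAt (by fun_prop)
    rw [ContinuousAt, Nat.cast_zero] at hcont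
    rw [Nat.cast_zero]
    refine (hcont.mono_left nhdsWithin_le_nhds).congr' ?_
    filter_upwards [self_mem_nhdsWithin,
      mem_nhdsWithin_of_mem_nhds (Ioi_mem_nhds (show (-1 : ℝ) < 0 by norm_num))] with ν h1 h2
    exact (hyp ν h2 h1).symm
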